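/- Let $0<\delta<1$ be a constant. A graph $G=(V,E)$ on $n=|V|$ vertices is called $\delta$-dense if all its degrees are at least $\delta n$. The following randomized algorithm (Algorithm 1) takes a $\delta$-dense graph $G$. 1. Select a random set $R'\subseteq V$ of $k$ vertices, the roots, where $k=O(\frac1\delta\log\log n)$ (all of $V$ if $k>n$). 2. For each box size $B$ with $\delta n\le B\le n/2$, in increasing order: prepare $b=\lceil n/B\rceil$ boxes $0,\dots,b-1$ with $B$ places each, and for each of the $b^{|R'|}$ placements $u\mapsto B(u)$ of the roots into the boxes do the following. (a) Build the bipartite auxiliary graph $G'$ with sides $V$ and the set of boxes: $v\in V$ is joined to the boxes of the interval $I_v=\bigcap_{u\in R',\,d(u,v)\le 2}\{B(u)-2,\dots,B(u)+2\}\cap\{0,\dots,b-1\}$, where a root may only use its own box. The distances are found by breadth-first search from the roots. (b) Run a matching algorithm (that of Hopcroft and Karp) on $G'$, in which every vertex may be matched to at most one box and every box to at most $B$ vertices. (c) If all vertices are matched, return the corresponding layout; otherwise continue. Running time is the worst-case number of steps of a random access machine with unit costs, over all input graphs and all outcomes of the random choices. The numbers $k$ and $\lceil\delta n\rceil$ are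 given as parameters. Claim. There is a constant $C$ depending only on $\delta$ such that, for every $\delta$-dense graph on $n\ge1$ vertices, every auxiliary graph $G'$ has at most $Cn$ vertices and at most $Cn$ edges, and the matching step (b) takes at most $Cn^{1.5}$ steps. Algorithm 1 runs in time $O(n^{4+o(1)})$: for every constant $a$ there are a constant $C'$ and a function $\varepsilon(n)\to0$, depending only on $\delta$ and $a$, such that for every $n\ge3$, every $\delta$-dense graph on $n$ vertices, every $k\le \frac a\delta\log\log n$ and every outcome of the random choices, Algorithm 1 stops after at most $C'n^{4+\varepsilon(n)}$ steps. -/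

import Mathlib

namespace DenseBandwidth

/-! A small random access machine. Programs compute with natural numbers held in registers and in
two-dimensional arrays (a one-dimensional array uses column `0`). The only arithmetic is addition
and truncated subtraction. Every elementary operation costs one step. -/

/-- The registers. -/
inductive Reg
  | n | k | s | cap | nb | total | b | p | q | i | j | t | h | u | v | w | c | l | r | z
  | lo | hi | m | matched | tail | best | d | x | act
  deriving DecidableEq

/-- The arrays. -/
inductive Arr
  | adj | perm | place | near | deg | nbr | mate | cnt | slot | lev | queue | ptr | bptr
  | stk | via | label
  deriving DecidableEq

/-- Expressions. -/
inductive Exp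
  | lit (a : ℕ)
  | reg (y : Reg)
  | get (a : Arr) (row col : Exp)
  | add (e f : Exp)
  | sub (e f : Exp)

instance : Coe Reg Exp := ⟨Exp.reg⟩
instance (a : ℕ) : OfNat Exp a := ⟨Exp.lit a⟩
instance : Add Exp := ⟨Exp.add⟩
instance : Sub Exp := ⟨Exp.sub⟩

/-- Tests. -/
inductive Test
  | lt (e f : Exp)
  | eq (e f : Exp)

/-- Commands. `draw y e` puts a random number below the value of `e` into `y`. `loop y e body`
evaluates `e` once, to `N` say, and runs `body` with `y = 0, …, N - 1`. `brk` leaves the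
innermost loop and `ret` ends the program. -/
inductive Cmd
  | skip
  | set (y : Reg) (e : Exp)
  | put (a : Arr) (row col : Exp) (e : Exp)
  | draw (y : Reg) (e : Exp)
  | seq (f g : Cmd)
  | branch (e : Test) (f g : Cmd)
  | loop (y : Reg) (e : Exp) (body : Cmd)
  | brk
  | ret

/-- The memory, together with the number `drawn` of random numbers used so far. -/
structure State where
  reg : Reg → ℕ
  arr : Arr → ℕ → ℕ → ℕ
  drawn : ℕ

def State.setReg (σ : State) (y : Reg) (a : ℕ) : State :=
  { σ with reg := fun y' => if y' = y then a else σ.reg y' }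

def State.setArr (σ : State) (a : Arr) (row col e : ℕ) : State :=
  { σ with arr := fun a' row' col' =>
      if a' = a ∧ row' = row ∧ col' = col then e else σ.arr a' row' col' }

def Exp.eval (σ : State) : Exp → ℕ
  | .lit a => a
  | .reg y => σ.reg y
  | .get a e f => σ.arr a (e.eval σ) (f.eval σ)
  | .add e f => e.eval σ + f.eval σ
  | .sub e f => e.eval σ - f.eval σ

/-- Number of steps for evaluating an expression: one for each operand and each operation. -/
def Exp.cost : Exp → ℕ
  | .lit _ => 1
  | .reg _ => 1
  | .get _ e f => e.cost + f.cost + 1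
  | .add e f => e.cost + f.cost + 1
  | .sub e f => e.cost + f.cost + 1

def Test.eval (σ : State) : Test → Bool
  | .lt e f => decide (e.eval σ < f.eval σ)
  | .eq e f => decide (e.eval σ = f.eval σ)

def Test.cost : Test → ℕ
  | .lt e f => e.cost + f.cost + 1
  | .eq e f => e.cost + f.cost + 1

/-- How a command ends: normally, by `brk`, or by `ret`. -/
inductive Exit
  | next
  | brk
  | ret
  deriving DecidableEq

/-- The result of running a command: the new memory, how it ended, the number of steps. -/
structure Outcome where
  st : State
  exit : Exit
  cost : ℕ

/-- `N` further iterations of a loop, starting with the value `a` of the loop variable `y`. -/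
def iterate (body : State → Outcome) (y : Reg) : ℕ → ℕ → State → Outcome
  | 0, _, σ => ⟨σ, .next, 1⟩
  | N + 1, a, σ =>
    let o := body (σ.setReg y a)
    match o.exit with
    | .next =>
      let o' := iterate body y N (a + 1) o.st
      ⟨o'.st, o'.exit, o.cost + o'.cost + 1⟩
    | .brk => ⟨o.st, .next, o.cost + 1⟩
    | .ret => ⟨o.st, .ret, o.cost + 1⟩

/-- Running a command. The sequence `ω` supplies the outcomes of the random draws. -/
def exec (ω : ℕ → ℕ) : Cmd → State → Outcome
  | .skip, σ => ⟨σ, .next, 1⟩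
  | .set y e, σ => ⟨σ.setReg y (e.eval σ), .next, e.cost + 1⟩
  | .put a e f g, σ =>
    ⟨σ.setArr a (e.eval σ) (f.eval σ) (g.eval σ), .next, e.cost + f.cost + g.cost + 1⟩
  | .draw y e, σ =>
    ⟨{ σ.setReg y (ω σ.drawn % e.eval σ) with drawn := σ.drawn + 1 }, .next, e.cost + 1⟩
  | .seq f g, σ =>
    let o := exec ω f σ
    match o.exit with
    | .next =>
      let o' := exec ω g o.st
      ⟨o'.st, o'.exit, o.cost + o'.cost⟩
    | .brk => o
    | .ret => o
  | .branch e f g, σ =>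
    let o := bif e.eval σ then exec ω f σ else exec ω g σ
    ⟨o.st, o.exit, e.cost + o.cost⟩
  | .loop y e body, σ =>
    let o := iterate (exec ω body) y (e.eval σ) 0 σ
    ⟨o.st, o.exit, e.cost + o.cost⟩
  | .brk, σ => ⟨σ, .brk, 1⟩
  | .ret, σ => ⟨σ, .ret, 1⟩

section Programs

open Reg Arr Exp Test Cmd

local infix:52 " ≔ " => Cmd.set
local infixr:50 " ;; " => Cmd.seq
local infix:55 " ≺ " => Test.lt
local infix:55 " ≡≡ " => Test.eq

/-- Choose a random subset of `k` vertices (of all the vertices if there are fewer than `k`), by a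
partial random shuffle. The roots are `perm 0, …, perm (k - 1)`. -/
def selectRoots : Cmd :=
  branch (n ≺ k) (k ≔ n) skip ;;
  loop i n (put perm i 0 i) ;;
  loop i k (
    draw j (n - i) ;;
    j ≔ j + i ;;
    t ≔ get perm i 0 ;;
    put perm i 0 (get perm j 0) ;;
    put perm j 0 t)

/-- Compute the number `nb = ⌈n / cap⌉` of boxes of size `cap`. -/
def prepareLayout : Cmd :=
  nb ≔ 0 ;;
  t ≔ 0 ;;
  loop i n (
    branch (t ≺ n)
      (t ≔ t + cap ;; nb ≔ nb + 1)
      brk)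

/-- Compute the number `total = nb ^ k` of placements of the roots into the boxes, and start with
the placement of all the roots into box `0`. -/
def firstPlacement : Cmd :=
  total ≔ 1 ;;
  loop i k (
    put place i 0 0 ;;
    q ≔ 0 ;;
    loop j nb (q ≔ q + total) ;;
    total ≔ q)

/-- Pass to the next placement, counting in base `nb`. -/
def nextPlacement : Cmd :=
  loop i k (
    put place i 0 (get place i 0 + 1) ;;
    branch (get place i 0 ≺ nb)
      brk
      (put place i 0 0))

/-- Breadth first search of depth two from every root: afterwards `near i v` is the distance from
the `i`-th root to `v` if that is at most two, and it is `3` otherwise. -/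
def searchFromRoots : Cmd :=
  loop i k (
    loop v n (put near i v 3) ;;
    put near i (get perm i 0) 0 ;;
    loop h 2 (
      loop w n (
        branch (get near i w ≡≡ h)
          (loop v n (
            branch (get adj w v ≡≡ 1)
              (branch (h + 1 ≺ get near i v) (put near i v (h + 1)) skip)
              skip))
          skip)))

/-- Build the auxiliary graph. Its left side is the set of vertices of the input graph and its
right side is the set of boxes `0, …, nb - 1`. The neighbours of `v` are the boxes of the interval
`I_v = {lo, …, hi}`, the intersection over the roots `u` at distance at most two from `v` of
`{B(u) - 2, …, B(u) + 2}`, where `B(u)` is the box of `u`; a root has to stay in its own box.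
They are listed as `nbr v 0, …, nbr v (deg v - 1)`, and `m` is the number of edges. -/
def buildAuxGraph : Cmd :=
  searchFromRoots ;;
  m ≔ 0 ;;
  loop v n (
    lo ≔ 0 ;;
    hi ≔ nb - 1 ;;
    loop i k (
      branch (get near i v ≺ 3)
        (branch (get near i v ≡≡ 0) (r ≔ 0) (r ≔ 2) ;;
          branch (lo ≺ get place i 0 - r) (lo ≔ get place i 0 - r) skip ;;
          branch (get place i 0 + r ≺ hi) (hi ≔ get place i 0 + r) skip)
        skip) ;;
    put deg v 0 (hi + 1 - lo) ;;
    loop t (get deg v 0) (put nbr v t (lo + t)) ;;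
    m ≔ m + get deg v 0)

/-- The breadth first part of a phase of the matching algorithm: `lev j` becomes the number of
full boxes that a shortest alternating path from a free vertex to box `j` passes before it gets to
`j` (and `nb` if there is no such path); `best` becomes the least level of a box with a free place
(and `nb` if no such box is reached). -/
def findLevels : Cmd :=
  loop j nb (put lev j 0 nb ;; put bptr j 0 0) ;;
  tail ≔ 0 ;;
  best ≔ nb ;;
  loop v n (
    put ptr v 0 0 ;;
    branch (get mate v 0 ≡≡ 0)
      (loop t (get deg v 0) (
        j ≔ get nbr v t ;;
        branch (get lev j 0 ≡≡ nb)
          (put lev j 0 0 ;; put queue tail 0 j ;; tail ≔ tail + 1)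
          skip))
      skip) ;;
  loop h nb (
    branch (h ≺ tail)
      (j ≔ get queue h 0 ;;
        branch (get cnt j 0 ≺ cap)
          (branch (get lev j 0 ≺ best) (best ≔ get lev j 0) skip)
          (loop c (get cnt j 0) (
            w ≔ get slot j c ;;
            loop t (get deg w 0) (
              u ≔ get nbr w t ;;
              branch (get lev u 0 ≡≡ nb)
                (put lev u 0 (get lev j 0 + 1) ;; put queue tail 0 u ;; tail ≔ tail + 1)
                skip))))
      brk)

/-- Augment along the path that was found: the last vertex `v` of the path takes a free place of
box `j`, and every earlier vertex takes the place of its successor on the path. -/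
def augment : Cmd :=
  put slot j (get cnt j 0) v ;;
  put cnt j 0 (get cnt j 0 + 1) ;;
  put mate v 0 1 ;;
  loop c nb (
    branch (0 ≺ d)
      (d ≔ d - 1 ;;
        v ≔ get stk d 0 ;;
        j ≔ get via d 0 ;;
        put slot j (get bptr j 0) v ;;
        put bptr j 0 (get bptr j 0 + 1) ;;
        put mate v 0 1)
      brk) ;;
  matched ≔ matched + 1 ;;
  act ≔ 0

/-- The depth first part of a phase: a maximal set of disjoint shortest augmenting paths, as a
single loop over the steps of the search. The current path is `stk 0, via 0, stk 1, …, stk d`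
(`act = 1`), or there is none and `x` is the next vertex to start from (`act = 0`). Every place of
a box and every edge of the auxiliary graph is used at most once, so `m + 4 n + 1` steps of the
search are enough. -/
def augmentPaths : Cmd :=
  x ≔ 0 ;;
  act ≔ 0 ;;
  loop z (m + n + n + n + n + 1) (
    branch (act ≡≡ 0)
      (branch (x ≺ n)
        (branch (get mate x 0 ≡≡ 0) (put stk 0 0 x ;; d ≔ 0 ;; act ≔ 1) skip ;;
          x ≔ x + 1)
        brk)
      (v ≔ get stk d 0 ;;
        branch (get ptr v 0 ≺ get deg v 0)
          (j ≔ get nbr v (get ptr v 0) ;;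
            branch (get lev j 0 ≡≡ d)
              (branch (get cnt j 0 ≺ cap)
                augment
                (branch (d ≺ best)
                  (branch (get bptr j 0 ≺ get cnt j 0)
                    (put via d 0 j ;;
                      put stk (d + 1) 0 (get slot j (get bptr j 0)) ;;
                      d ≔ d + 1)
                    (put ptr v 0 (get ptr v 0 + 1)))
                  (put ptr v 0 (get ptr v 0 + 1))))
              (put ptr v 0 (get ptr v 0 + 1)))
          (branch (0 ≺ d)
            (d ≔ d - 1 ;;
              put bptr (get via d 0) 0 (get bptr (get via d 0) 0 + 1))
            (act ≔ 0))))

/-- A maximum matching of the vertices to the `cap` places of each box, by the algorithm of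
Hopcroft and Karp on the auxiliary graph. The vertices matched to box `j` are
`slot j 0, …, slot j (cnt j - 1)`, and `matched` counts the matched vertices. The length of a
shortest augmenting path grows from phase to phase, and such a path passes every box at most once,
so `nb` phases are enough. -/
def matching : Cmd :=
  matched ≔ 0 ;;
  loop v n (put mate v 0 0) ;;
  loop j nb (put cnt j 0 0) ;;
  loop l nb (
    findLevels ;;
    branch (best ≺ nb) augmentPaths brk)

/-- Turn the matching into a labelling of the vertices, box by box, and return it. -/
def returnLayout : Cmd :=
  l ≔ 0 ;;
  loop j nb (
    loop c (get cnt j 0) (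
      l ≔ l + 1 ;;
      put label (get slot j c) 0 l)) ;;
  ret

/-- The approximation algorithm for the bandwidth of dense graphs. Input: the number `n` of
vertices, the adjacency matrix `adj`, the number `k` of roots, and the least box size `s`. -/
def algorithm1 : Cmd :=
  selectRoots ;;
  loop b n (
    cap ≔ s + b ;;
    branch (n ≺ cap + cap)
      brk
      (prepareLayout ;;
        firstPlacement ;;
        loop p total (
          buildAuxGraph ;;
          matching ;;
          branch (matched ≡≡ n) returnLayout nextPlacement)))

end Programs

/-- `G` is `δ`-dense: every vertex has degree at least `δ n`. -/
def IsDense {n : ℕ} (δ : ℝ) (G : SimpleGraph (Fin n)) : Prop :=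
  ∀ v, δ * n ≤ ((G.neighborSet v).ncard : ℝ)

open Classical in
/-- The array `adj` of the memory holds the adjacency matrix of `G`. -/
noncomputable def adjMatrix {n : ℕ} (G : SimpleGraph (Fin n)) (u v : ℕ) : ℕ :=
  if ∃ (hu : u < n) (hv : v < n), G.Adj ⟨u, hu⟩ ⟨v, hv⟩ then 1 else 0

/-- The memory at the start: the graph `G`, the size `k` of the random set of roots, the least box
size `⌈δ n⌉`, and zeros. -/
noncomputable def input {n : ℕ} (δ : ℝ) (G : SimpleGraph (Fin n)) (k : ℕ) : State where
  reg y := match y with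
    | .n => n
    | .k => k
    | .s => ⌈δ * n⌉₊
    | _ => 0
  arr a := match a with
    | .adj => adjMatrix G
    | _ => fun _ _ => 0
  drawn := 0

/-- The running time of the algorithm on a graph `G`, when its random draws are given by `ω`. -/
noncomputable def runningTime {n : ℕ} (δ : ℝ) (G : SimpleGraph (Fin n)) (k : ℕ) (ω : ℕ → ℕ) : ℕ :=
  (exec ω algorithm1 (input δ G k)).cost

/-- The memory when the algorithm starts to build an auxiliary graph for `G` with boxes of size
`cap`. The roots and their placement are arbitrary. -/
structure AtPlacement {n : ℕ} (G : SimpleGraph (Fin n)) (cap : ℕ) (σ : State) : Prop where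
  reg_n : σ.reg .n = n
  reg_cap : σ.reg .cap = cap
  reg_nb : σ.reg .nb = ⌈(n : ℝ) / cap⌉₊
  arr_adj : σ.arr .adj = adjMatrix G

/-- Number of vertices of the auxiliary graph in memory. -/
def auxVertices (σ : State) : ℕ := σ.reg .n + σ.reg .nb

/-- Number of edges of the auxiliary graph in memory. -/
def auxEdges (σ : State) : ℕ := ∑ v ∈ Finset.range (σ.reg .n), σ.arr .deg v 0

end DenseBandwidth

set_option linter.constructorNameAsVariable false

/-! The number of boxes is bounded by a constant. With `K = ⌈1/δ⌉`, a box size of at least `δ n`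
gives at most `K` boxes, so every vertex has degree at most `K` in the auxiliary graph, which
therefore has at most `n + K` vertices and `K n` edges. The matching runs at most `K` phases. Every
phase costs `O(K² n)`, because its loops are limited by explicit counts. A matching step is thus
linear in `n`, stronger than the exponent `3/2`.

For the whole algorithm there are at most `n` box sizes and at most `K ^ k` placements for each. The
most expensive part of a placement is the search from the roots, with `O((k + 1) n²)` steps. The
product is at most a constant times `(2 K) ^ k * n ^ 3`. Since `k = O(log log n)`, the power `(2 K)
^ k` is polylogarithmic in `n`, and the crude estimate `O(n)` (`exists_pow_log_log_le`) already
gives `O(n ^ 4)`.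

Neither the correctness of the matching nor that of the search is needed: only upper bounds on loop
counts enter. `Runs` propagates just the invariants that bound these counts (degrees, box contents,
validity of stored indices). It yields `Cmd.bound`, which `Cmd.bound_le_weight_mul` turns into the
largest nested product of counts times a constant of the program text. -/

namespace DenseBandwidth

section Logic

/-! A program logic for bounding running times. `N e` is a bound on the value of `e` whenever a
loop with the count `e` is entered. -/

/-- The bound on the number of steps that follows from the bounds `N` on the loop counts. -/
def Cmd.bound (N : Exp → ℕ) : Cmd → ℕ
  | .skip => 1
  | .set _ e => e.cost + 1
  | .put _ e f g => e.cost + f.cost + g.cost + 1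
  | .draw _ e => e.cost + 1
  | .seq f g => f.bound N + g.bound N
  | .branch e f g => e.cost + (f.bound N + g.bound N)
  | .loop _ e body => e.cost + (N e * (body.bound N + 1) + 1)
  | .brk => 1
  | .ret => 1

/-- The largest product of the counts of nested loops. -/
def Cmd.weight (N : Exp → ℕ) : Cmd → ℕ
  | .seq f g => max (f.weight N) (g.weight N)
  | .branch _ f g => max (f.weight N) (g.weight N)
  | .loop _ e body => N e * body.weight N
  | _ => 1

theorem Cmd.one_le_weight {N : Exp → ℕ} (hN : ∀ e, 1 ≤ N e) (c : Cmd) : 1 ≤ c.weight N := by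
  induction c with
  | seq f g hf hg => exact hf.trans (le_max_left _ _)
  | branch e f g hf hg => exact hf.trans (le_max_left _ _)
  | loop y e body ih => exact one_le_mul (hN e) ih
  | _ => exact le_rfl

/-- An elementary step is repeated at most as often as the product of the counts of the loops around
it. The other factor, the bound with all counts equal to `1`, depends on the program text alone.
Counts of at least `1` let the weight absorb the overhead of entering and leaving loops. -/
theorem Cmd.bound_le_weight_mul {N : Exp → ℕ} (hN : ∀ e, 1 ≤ N e) (c : Cmd) :
    c.bound N ≤ c.weight N * c.bound (fun _ => 1) := by
  induction c with
  | seq f g hf hg =>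
    simp only [bound, weight, mul_add]
    exact add_le_add (hf.trans (Nat.mul_le_mul_right _ (le_max_left _ _)))
      (hg.trans (Nat.mul_le_mul_right _ (le_max_right _ _)))
  | branch e f g hf hg =>
    simp only [bound, weight, mul_add]
    refine add_le_add (Nat.le_mul_of_pos_left _ ?_)
      (add_le_add (hf.trans (Nat.mul_le_mul_right _ (le_max_left _ _)))
        (hg.trans (Nat.mul_le_mul_right _ (le_max_right _ _))))
    exact (one_le_weight hN f).trans (le_max_left _ _)
  | loop y e body ih =>
    simp only [bound, weight]
    have h1 := hN e
    have h2 := one_le_weight hN body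
    have h3 := one_le_mul h1 h2
    have h4 : N e * body.bound N ≤ N e * (body.weight N * body.bound (fun _ => 1)) :=
      Nat.mul_le_mul_left _ ih
    have h5 : N e * 1 ≤ N e * body.weight N := Nat.mul_le_mul_left _ h2
    have h6 : 1 * e.cost ≤ (N e * body.weight N) * e.cost := Nat.mul_le_mul_right _ h3
    linarith
  | _ => simp [bound, weight]

/-- Whether a command may change a register. -/
def Cmd.modReg (y : Reg) : Cmd → Bool
  | .set z _ => decide (y = z)
  | .draw z _ => decide (y = z)
  | .seq f g => f.modReg y || g.modReg y
  | .branch _ f g => f.modReg y || g.modReg y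
  | .loop z _ body => decide (y = z) || body.modReg y
  | _ => false

/-- Whether a command may change an array. -/
def Cmd.modArr (a : Arr) : Cmd → Bool
  | .put a' _ _ _ => decide (a = a')
  | .seq f g => f.modArr a || g.modArr a
  | .branch _ f g => f.modArr a || g.modArr a
  | .loop _ _ body => body.modArr a
  | _ => false

/-- Whether a command contains `ret`. -/
def Cmd.hasRet : Cmd → Bool
  | .seq f g => f.hasRet || g.hasRet
  | .branch _ f g => f.hasRet || g.hasRet
  | .loop _ _ body => body.hasRet
  | .ret => true
  | _ => false

/-- `σ` and `τ` agree on everything that `c` does not change. -/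
structure Frame (c : Cmd) (σ τ : State) : Prop where
  reg : ∀ y, c.modReg y = false → τ.reg y = σ.reg y
  arr : ∀ a, c.modArr a = false → τ.arr a = σ.arr a

@[simp] theorem State.reg_setReg (σ : State) (y z : Reg) (a : ℕ) :
    (σ.setReg y a).reg z = if z = y then a else σ.reg z := rfl

@[simp] theorem State.arr_setReg (σ : State) (y : Reg) (a : ℕ) : (σ.setReg y a).arr = σ.arr := rfl

@[simp] theorem State.reg_setArr (σ : State) (a : Arr) (i j x : ℕ) :
    (σ.setArr a i j x).reg = σ.reg := rfl

theorem State.arr_setArr (σ : State) (a a' : Arr) (i j x i' j' : ℕ) :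
    (σ.setArr a i j x).arr a' i' j' =
      if a' = a ∧ i' = i ∧ j' = j then x else σ.arr a' i' j' := rfl

theorem State.arr_setArr_ne (σ : State) {a a' : Arr} (h : a' ≠ a) (i j x : ℕ) :
    (σ.setArr a i j x).arr a' = σ.arr a' := by
  funext i' j'
  simp [State.arr_setArr, h]

theorem Frame.refl (c : Cmd) (σ : State) : Frame c σ σ := ⟨fun _ _ => rfl, fun _ _ => rfl⟩

theorem Frame.trans {c : Cmd} {σ τ ρ : State} (h : Frame c σ τ) (h' : Frame c τ ρ) :
    Frame c σ ρ :=
  ⟨fun y hy => (h'.reg y hy).trans (h.reg y hy), fun a ha => (h'.arr a ha).trans (h.arr a ha)⟩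

theorem Frame.mono {c c' : Cmd} {σ τ : State} (h : Frame c σ τ)
    (hr : ∀ y, c'.modReg y = false → c.modReg y = false)
    (ha : ∀ a, c'.modArr a = false → c.modArr a = false) : Frame c' σ τ :=
  ⟨fun y hy => h.reg y (hr y hy), fun a h' => h.arr a (ha a h')⟩

theorem frame_setReg {y : Reg} {e : Exp} {body : Cmd} (σ : State) (a : ℕ) :
    Frame (.loop y e body) σ (σ.setReg y a) := by
  refine ⟨fun z hz => ?_, fun _ _ => rfl⟩
  simp only [Cmd.modReg, Bool.or_eq_false_iff, decide_eq_false_iff_not] at hz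
  simp [hz.1]

theorem frame_iterate (ω : ℕ → ℕ) {y : Reg} {e : Exp} {body : Cmd}
    (h : ∀ σ, Frame body σ (exec ω body σ).st) (M a : ℕ) (σ : State) :
    Frame (.loop y e body) σ (iterate (exec ω body) y M a σ).st := by
  induction M generalizing a σ with
  | zero => exact Frame.refl _ _
  | succ M ih =>
    have h' : Frame (.loop y e body) σ (exec ω body (σ.setReg y a)).st :=
      (frame_setReg σ a).trans ((h _).mono
        (fun z hz => by simp only [Cmd.modReg, Bool.or_eq_false_iff] at hz; exact hz.2)
        (fun z hz => hz))
    simp only [iterate]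
    split
    · exact h'.trans (ih _ _)
    · exact h'
    · exact h'

/-- What a command leaves alone is read off its syntax, so the side conditions close by `rfl` and
loop invariants need not mention untouched registers or arrays. -/
theorem frame_exec (ω : ℕ → ℕ) (c : Cmd) (σ : State) : Frame c σ (exec ω c σ).st := by
  induction c generalizing σ with
  | skip | brk | ret => exact Frame.refl _ _
  | set y e =>
    refine ⟨fun z hz => ?_, fun _ _ => rfl⟩
    simp only [Cmd.modReg, decide_eq_false_iff_not] at hz
    simp [exec, hz]
  | draw y e =>
    refine ⟨fun z hz => ?_, fun _ _ => rfl⟩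
    simp only [Cmd.modReg, decide_eq_false_iff_not] at hz
    simp [exec, hz]
  | put a e f g =>
    refine ⟨fun _ _ => rfl, fun a' ha => ?_⟩
    simp only [Cmd.modArr, decide_eq_false_iff_not] at ha
    exact State.arr_setArr_ne _ ha _ _ _
  | seq f g hf hg =>
    have h1 : Frame (.seq f g) σ (exec ω f σ).st := (hf σ).mono
      (fun z hz => by simp only [Cmd.modReg, Bool.or_eq_false_iff] at hz; exact hz.1)
      (fun z hz => by simp only [Cmd.modArr, Bool.or_eq_false_iff] at hz; exact hz.1)
    have h2 : Frame (.seq f g) (exec ω f σ).st (exec ω g (exec ω f σ).st).st := (hg _).mono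
      (fun z hz => by simp only [Cmd.modReg, Bool.or_eq_false_iff] at hz; exact hz.2)
      (fun z hz => by simp only [Cmd.modArr, Bool.or_eq_false_iff] at hz; exact hz.2)
    simp only [exec]
    split
    · exact h1.trans h2
    · exact h1
    · exact h1
  | branch e f g hf hg =>
    simp only [exec]
    cases e.eval σ
    · exact (hg σ).mono
        (fun z hz => by simp only [Cmd.modReg, Bool.or_eq_false_iff] at hz; exact hz.2)
        (fun z hz => by simp only [Cmd.modArr, Bool.or_eq_false_iff] at hz; exact hz.2)
    · exact (hf σ).mono
        (fun z hz => by simp only [Cmd.modReg, Bool.or_eq_false_iff] at hz; exact hz.1)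
        (fun z hz => by simp only [Cmd.modArr, Bool.or_eq_false_iff] at hz; exact hz.1)
  | loop y e body ih => exact frame_iterate ω ih _ _ _

theorem exit_iterate_ne_ret (ω : ℕ → ℕ) {y : Reg} {body : Cmd}
    (h : ∀ σ, (exec ω body σ).exit ≠ .ret) (M a : ℕ) (σ : State) :
    (iterate (exec ω body) y M a σ).exit ≠ .ret := by
  induction M generalizing a σ with
  | zero => simp [iterate]
  | succ M ih =>
    simp only [iterate]
    split
    · exact ih _ _
    · simp
    · next h' => exact absurd h' (h _)

/-- `Runs` asserts nothing about the memory after `ret`; this excludes that case when the final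
memory matters. -/
theorem exit_ne_ret (ω : ℕ → ℕ) {c : Cmd} (hc : c.hasRet = false) (σ : State) :
    (exec ω c σ).exit ≠ .ret := by
  induction c generalizing σ with
  | seq f g hf hg =>
    simp only [Cmd.hasRet, Bool.or_eq_false_iff] at hc
    simp only [exec]
    split
    · exact hg hc.2 _
    · exact hf hc.1 _
    · exact hf hc.1 _
  | branch e f g hf hg =>
    simp only [Cmd.hasRet, Bool.or_eq_false_iff] at hc
    simp only [exec]
    cases e.eval σ
    · exact hg hc.2 _
    · exact hf hc.1 _
  | loop y e body ih => exact exit_iterate_ne_ret ω (ih hc) _ _ _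
  | ret => simp [Cmd.hasRet] at hc
  | _ => simp [exec]

/-- Started in `σ`, the command `c` obeys the bound on the number of steps; if it ends normally,
then `Q` holds, and if it ends by `brk`, then `R` holds. -/
structure Runs (ω : ℕ → ℕ) (N : Exp → ℕ) (c : Cmd) (Q R : State → Prop) (σ : State) : Prop where
  cost : (exec ω c σ).cost ≤ c.bound N
  next : (exec ω c σ).exit = .next → Q (exec ω c σ).st
  brk : (exec ω c σ).exit = .brk → R (exec ω c σ).st

variable {ω : ℕ → ℕ} {N : Exp → ℕ}

/-- A command that does not end by `brk`, followed by an assertion. -/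
theorem Runs.consequence {c : Cmd} {P Q R : State → Prop} {σ : State}
    (h : Runs ω N c P (fun _ => False) σ) (hQ : ∀ τ, Frame c σ τ → P τ → Q τ) :
    Runs ω N c Q R σ :=
  ⟨h.cost, fun h' => hQ _ (frame_exec ω c σ) (h.next h'), fun h' => (h.brk h').elim⟩

theorem Runs.seq {f g : Cmd} {Q R : State → Prop} {σ : State}
    (h : Runs ω N f (fun τ => Runs ω N g Q R τ) R σ) : Runs ω N (.seq f g) Q R σ := by
  obtain ⟨h1, h2, h3⟩ := h
  cases hx : (exec ω f σ).exit with
  | next =>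
    have h4 := h2 hx
    refine ⟨?_, ?_, ?_⟩ <;> simp only [exec, hx, Cmd.bound]
    · exact add_le_add h1 h4.cost
    · exact h4.next
    · exact h4.brk
  | brk =>
    refine ⟨?_, ?_, ?_⟩ <;> simp only [exec, hx, Cmd.bound]
    · exact h1.trans (Nat.le_add_right _ _)
    · simp
    · exact fun _ => h3 hx
  | ret =>
    refine ⟨?_, ?_, ?_⟩ <;> simp only [exec, hx, Cmd.bound]
    · exact h1.trans (Nat.le_add_right _ _)
    · simp
    · simp

theorem Runs.branch {e : Test} {f g : Cmd} {Q R : State → Prop} {σ : State}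
    (h1 : e.eval σ = true → Runs ω N f Q R σ) (h0 : e.eval σ = false → Runs ω N g Q R σ) :
    Runs ω N (.branch e f g) Q R σ := by
  cases he : e.eval σ with
  | true =>
    have h := h1 he
    refine ⟨?_, ?_, ?_⟩ <;> simp only [exec, he, Cmd.bound, cond_true]
    · have := h.cost
      omega
    · exact h.next
    · exact h.brk
  | false =>
    have h := h0 he
    refine ⟨?_, ?_, ?_⟩ <;> simp only [exec, he, Cmd.bound, cond_false]
    · have := h.cost
      omega
    · exact h.next
    · exact h.brk

/-- Induction on the remaining iterations `L`, with the frame always measured from the state `σ₀` in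
which the loop was entered. A `brk` in the body is a normal end of the loop, so it has to establish
`Q` directly. -/
theorem runs_iterate {y : Reg} {e : Exp} {body : Cmd} {I : ℕ → State → Prop} {Q : State → Prop}
    {σ₀ : State} {M : ℕ}
    (hs : ∀ a < M, ∀ τ, Frame (.loop y e body) σ₀ τ → I a τ →
      Runs ω N body (I (a + 1)) (fun ρ => Frame (.loop y e body) σ₀ ρ → Q ρ) (τ.setReg y a))
    (hQ : ∀ τ, Frame (.loop y e body) σ₀ τ → I M τ → Q τ) (L a : ℕ) (hL : a + L = M) (σ : State)
    (hF : Frame (.loop y e body) σ₀ σ) (hI : I a σ) :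
    (iterate (exec ω body) y L a σ).cost ≤ L * (body.bound N + 1) + 1 ∧
      ((iterate (exec ω body) y L a σ).exit ≠ .ret →
        Q (iterate (exec ω body) y L a σ).st) ∧
      (iterate (exec ω body) y L a σ).exit ≠ .brk := by
  induction L generalizing a σ with
  | zero =>
    obtain rfl : a = M := by omega
    simpa [iterate] using hQ σ hF hI
  | succ L ih =>
    have h := hs a (by omega) σ hF hI
    have hF' : Frame (.loop y e body) σ₀ (exec ω body (σ.setReg y a)).st :=
      hF.trans ((frame_setReg σ a).trans ((frame_exec ω body _).mono
        (fun z hz => by simp only [Cmd.modReg, Bool.or_eq_false_iff] at hz; exact hz.2)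
        (fun z hz => hz)))
    have hc := h.cost
    have hm : (L + 1) * (body.bound N + 1) = L * (body.bound N + 1) + (body.bound N + 1) := by ring
    simp only [iterate]
    split
    · next hx =>
      obtain ⟨i1, i2, i3⟩ := ih (a + 1) (by omega) _ hF' (h.next hx)
      refine ⟨?_, i2, i3⟩
      simp only
      omega
    · next hx =>
      refine ⟨?_, fun _ => h.brk hx hF', by simp⟩
      simp only
      nlinarith [Nat.zero_le (L * (body.bound N + 1))]
    · next hx =>
      refine ⟨?_, by simp, by simp⟩
      simp only
      nlinarith [Nat.zero_le (L * (body.bound N + 1))]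

/-- The rule for loops, with the invariant `I a` before the iteration number `a`. -/
theorem Runs.loop {y : Reg} {e : Exp} {body : Cmd} (I : ℕ → State → Prop) {Q R : State → Prop}
    {σ : State} (hN : e.eval σ ≤ N e) (h0 : I 0 σ)
    (hs : ∀ a < e.eval σ, ∀ τ, Frame (.loop y e body) σ τ → I a τ →
      Runs ω N body (I (a + 1)) (fun ρ => Frame (.loop y e body) σ ρ → Q ρ) (τ.setReg y a))
    (hQ : ∀ τ, Frame (.loop y e body) σ τ → I (e.eval σ) τ → Q τ) :
    Runs ω N (.loop y e body) Q R σ := by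
  obtain ⟨h1, h2, h3⟩ := runs_iterate hs hQ (e.eval σ) 0 (by omega) σ (Frame.refl _ _) h0
  refine ⟨?_, fun hx => h2 ?_, fun hx => absurd hx h3⟩
  · simp only [exec, Cmd.bound]
    have := Nat.mul_le_mul_right (body.bound N + 1) hN
    omega
  · simp only [exec] at hx
    simp [hx]

/-- Backward symbolic execution. Loops are left to `Runs.loop`. -/
def wp (ω : ℕ → ℕ) (N : Exp → ℕ) : Cmd → (State → Prop) → (State → Prop) → State → Prop
  | .skip, Q, _, σ => Q σ
  | .set y e, Q, _, σ => Q (σ.setReg y (e.eval σ))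
  | .put a e f g, Q, _, σ => Q (σ.setArr a (e.eval σ) (f.eval σ) (g.eval σ))
  | .draw y e, Q, _, σ =>
    Q { σ.setReg y (ω σ.drawn % e.eval σ) with drawn := σ.drawn + 1 }
  | .seq f g, Q, R, σ => wp ω N f (wp ω N g Q R) R σ
  | .branch e f g, Q, R, σ =>
    (e.eval σ = true → wp ω N f Q R σ) ∧ (e.eval σ = false → wp ω N g Q R σ)
  | .loop y e body, Q, R, σ => Runs ω N (.loop y e body) Q R σ
  | .brk, _, R, σ => R σ
  | .ret, _, _, _ => True

theorem Runs.mono {c : Cmd} {P P' Q Q' : State → Prop} {σ : State} (h : Runs ω N c P P' σ)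
    (hQ : ∀ τ, P τ → Q τ) (hQ' : ∀ τ, P' τ → Q' τ) : Runs ω N c Q Q' σ :=
  ⟨h.cost, fun h' => hQ _ (h.next h'), fun h' => hQ' _ (h.brk h')⟩

/-- Loop-free code meets its cost bound by construction, so only the assertions remain to be proved;
costs reappear at loops, where `wp` is `Runs` itself. -/
theorem Runs.of_wp {c : Cmd} {Q R : State → Prop} {σ : State} (h : wp ω N c Q R σ) :
    Runs ω N c Q R σ := by
  induction c generalizing Q R σ with
  | seq f g hf hg => exact Runs.seq ((hf h).mono (fun _ h' => hg h') (fun _ h' => h'))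
  | branch e f g hf hg => exact Runs.branch (fun he => hf (h.1 he)) (fun he => hg (h.2 he))
  | loop y e body ih => exact h
  | _ => refine ⟨le_rfl, ?_, ?_⟩ <;> simp_all [exec, wp]

theorem Exp.ofNat_eq (a : ℕ) : (OfNat.ofNat a : Exp) = Exp.lit (OfNat.ofNat a) := rfl

theorem Exp.add_eq (e f : Exp) : e + f = Exp.add e f := rfl

theorem Exp.sub_eq (e f : Exp) : e - f = Exp.sub e f := rfl

end Logic

/-! ### Roots, boxes, placements and the auxiliary graph. -/

section Subprograms

attribute [local simp] wp Exp.eval Test.eval Exp.ofNat_eq Exp.add_eq Exp.sub_eq State.arr_setArr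

/-- Bounds on the loop counts of the algorithm, for `n` vertices, `k` roots, at most `K` boxes and
at most `T` placements. -/
def counts (n k K T : ℕ) : Exp → ℕ
  | .reg .n => n
  -- Not `k`, since `k = 0` is allowed and all counts must be at least `1`.
  | .reg .k => k + 1
  | .reg .nb => K
  | .reg .total => T
  | .get .deg _ _ => K
  | .get .cnt _ _ => n
  | .lit _ => 2
  -- This serves the search loop of `augmentPaths`: `m + 4 n + 1 ≤ (K + 5) n` if `m ≤ K n` and `1 ≤
  -- n`.
  | _ => (K + 5) * n

variable {ω : ℕ → ℕ} {n k K T : ℕ}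

theorem runs_selectRoots {σ : State} (hn : σ.reg .n = n) (hk : σ.reg .k ≤ k) :
    Runs ω (counts n k K T) selectRoots (fun τ => τ.reg .k ≤ k) (fun _ => False) σ := by
  refine Runs.seq (Runs.consequence (P := fun τ => τ.reg .k ≤ k) (.of_wp ?_) fun τ hF hk => ?_)
  · simp [hn]
    omega
  have en : τ.reg .n = n := (hF.reg .n rfl).trans hn
  clear hF
  refine Runs.of_wp ?_
  simp only [wp]
  refine Runs.loop (fun _ _ => True) ?_ trivial (fun _ _ _ _ _ => .of_wp (by simp)) ?_
  · simp [counts, en]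
  · rintro ρ hG -
    have ek := hG.reg .k rfl
    refine Runs.loop (fun _ _ => True) ?_ trivial (fun _ _ _ _ _ => .of_wp (by simp)) ?_
    · simp [counts, ek]
      omega
    · rintro π hH -
      rw [hH.reg .k rfl, ek]
      exact hk

/-- A box is added only while `nb * cap < n ≤ K * cap`, so `nb` cannot pass `K`. The first iteration
does add one, since `t = 0 < n`. -/
theorem runs_prepareLayout {σ : State} (hn : σ.reg .n = n) (hn1 : 1 ≤ n)
    (hK : n ≤ K * σ.reg .cap) :
    Runs ω (counts n k K T) prepareLayout (fun τ => 1 ≤ τ.reg .nb ∧ τ.reg .nb ≤ K)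
      (fun _ => False) σ := by
  refine Runs.of_wp ?_
  simp only [prepareLayout, wp]
  refine Runs.loop (fun a τ => τ.reg .t = τ.reg .nb * σ.reg .cap ∧ τ.reg .nb ≤ K ∧
    (1 ≤ a → 1 ≤ τ.reg .nb)) ?_ ?_ ?_ ?_
  · simp [counts, hn]
  · simp
  · rintro a ha τ hF ⟨h1, h2, h3⟩
    refine Runs.of_wp ?_
    have e1 := hF.reg .n rfl
    have e2 := hF.reg .cap rfl
    simp at e1 e2
    simp [e1, e2, hn]
    refine ⟨fun h => ⟨by rw [h1]; ring, ?_⟩, fun h _ => ⟨?_, h2⟩⟩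
    · have : τ.reg .nb * σ.reg .cap < K * σ.reg .cap := by omega
      exact Nat.lt_of_mul_lt_mul_right this
    · by_contra h0
      have : τ.reg .nb = 0 := by omega
      rw [this] at h1
      omega
  · rintro τ hF ⟨h1, h2, h3⟩
    simp [hn] at h3
    exact ⟨h3 hn1, h2⟩

theorem runs_firstPlacement {σ : State} (hk : σ.reg .k ≤ k) (hnb : σ.reg .nb ≤ K) :
    Runs ω (counts n k K T) firstPlacement (fun τ => τ.reg .total = σ.reg .nb ^ σ.reg .k)
      (fun _ => False) σ := by
  refine Runs.of_wp ?_
  simp only [firstPlacement, wp]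
  refine Runs.loop (fun a τ => τ.reg .total = σ.reg .nb ^ a) ?_ ?_ ?_ ?_
  · simp [counts]; omega
  · simp
  · rintro a ha τ hF h1
    refine Runs.of_wp ?_
    have e1 := hF.reg .nb rfl
    simp at e1
    simp
    refine Runs.loop (fun b ρ => ρ.reg .q = b * σ.reg .nb ^ a) ?_ ?_ ?_ ?_
    · simp [counts, e1, hnb]
    · simp
    · rintro b hb ρ hG h2
      have e2 := hG.reg .total rfl
      simp at e2
      refine Runs.of_wp ?_
      simp [e2, h1, h2]
      ring
    · rintro ρ hG h2
      simp [h2, e1]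
      ring
  · rintro τ hF h1
    simpa using h1

theorem runs_nextPlacement {σ : State} (hk : σ.reg .k ≤ k) :
    Runs ω (counts n k K T) nextPlacement (fun _ => True) (fun _ => False) σ := by
  refine Runs.of_wp ?_
  simp only [nextPlacement, wp]
  refine Runs.loop (fun a τ => True) ?_ ?_ ?_ ?_
  · simp [counts]; omega
  · simp
  · rintro a ha τ hF -
    refine Runs.of_wp ?_
    simp
  · simp

theorem runs_searchFromRoots {σ : State} (hn : σ.reg .n = n) (hk : σ.reg .k ≤ k) :
    Runs ω (counts n k K T) searchFromRoots (fun _ => True) (fun _ => False) σ := by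
  refine Runs.of_wp ?_
  simp only [searchFromRoots, wp]
  refine Runs.loop (fun a τ => True) ?_ trivial ?_ (fun _ _ _ => trivial)
  · simp [counts]; omega
  · rintro a ha τ hF -
    refine Runs.of_wp ?_
    have e1 := hF.reg .n rfl
    simp only [wp]
    refine Runs.loop (fun _ _ => True) ?_ trivial (fun _ _ _ _ _ => .of_wp ?_) ?_
    · simp [counts, e1, hn]
    · simp
    rintro τ₁ hF1 -
    have e2 := hF1.reg .n rfl
    refine Runs.loop (fun _ _ => True) ?_ trivial (fun _ _ τ₂ hF2 _ => .of_wp ?_) (by simp)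
    · simp [counts]
    have e3 := hF2.reg .n rfl
    simp only [wp]
    refine Runs.loop (fun _ _ => True) ?_ trivial (fun _ _ τ₃ hF3 _ => .of_wp ?_) (by simp)
    · simp at e1 e2 e3
      simp [counts, e1, e2, e3, hn]
    have e4 := hF3.reg .n rfl
    simp only [wp]
    refine ⟨fun _ => ?_, fun _ => trivial⟩
    refine Runs.loop (fun _ _ => True) ?_ trivial (fun _ _ τ₃ hF3 _ => .of_wp ?_) (by simp)
    · simp at e1 e2 e3 e4
      simp [counts, e1, e2, e3, e4, hn]
    simp

/-- The bounds on the auxiliary graph on which the running time of the matching rests. -/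
structure AuxBounded (σ : State) : Prop where
  deg_le : ∀ v < σ.reg .n, σ.arr .deg v 0 ≤ σ.reg .nb
  nbr_lt : ∀ v < σ.reg .n, ∀ t < σ.arr .deg v 0, σ.arr .nbr v t < σ.reg .nb
  m_le : σ.reg .m ≤ σ.reg .n * σ.reg .nb

/-- Whatever the search found, `hi` starts at `nb - 1` and only decreases, so the listed boxes `lo +
t ≤ hi` are valid and there are at most `nb` of them. If `lo > hi`, truncated subtraction makes the
degree `0`. The hypothesis `1 ≤ nb` is what makes `nb - 1 < nb`. -/
theorem runs_buildAuxGraph {σ : State} (hn : σ.reg .n = n) (hk : σ.reg .k ≤ k)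
    (hnb1 : 1 ≤ σ.reg .nb) (hnb : σ.reg .nb ≤ K) :
    Runs ω (counts n k K T) buildAuxGraph AuxBounded (fun _ => False) σ := by
  refine Runs.seq ((runs_searchFromRoots hn hk).consequence fun σ₁ hF₁ _ => .of_wp ?_)
  have en : σ₁.reg .n = n := (hF₁.reg .n rfl).trans hn
  have ek : σ₁.reg .k ≤ k := (hF₁.reg .k rfl).trans_le hk
  have eb := hF₁.reg .nb rfl
  rw [← eb] at hnb hnb1
  clear hF₁ eb hn hk
  simp only [wp]
  refine Runs.loop (fun a τ =>
    (∀ v < a, τ.arr .deg v 0 ≤ σ₁.reg .nb ∧ ∀ t < τ.arr .deg v 0, τ.arr .nbr v t < σ₁.reg .nb) ∧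
    τ.reg .m ≤ a * σ₁.reg .nb) ?_ ?_ ?_ ?_
  · simp [counts, en]
  · simp
  · rintro a ha τ hF ⟨h1, h2⟩
    have fk := hF.reg .k rfl
    have fb := hF.reg .nb rfl
    simp at fk fb
    refine Runs.of_wp ?_
    simp only [wp]
    refine Runs.loop (fun _ ρ => ρ.reg .hi < σ₁.reg .nb) ?_ ?_ ?_ ?_
    · simp [counts, fk]; omega
    · simp [fb]; omega
    · rintro i hi ρ hG h3
      refine Runs.of_wp ?_
      simp [h3]
      intro _
      constructor <;> intro _ <;> constructor <;> intro _ <;> intros <;> omega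
    · rintro ρ hG h3
      have gm := hG.reg .m rfl
      have gd := hG.arr .deg rfl
      have gn := hG.arr .nbr rfl
      have gv := hG.reg .v rfl
      simp at gm gd gn gv
      refine Runs.loop (fun b π => (∀ v < a, ∀ t, π.arr .nbr v t = τ.arr .nbr v t) ∧
        ∀ t < b, π.arr .nbr a t < σ₁.reg .nb) ?_ ?_ ?_ ?_
      · simp [counts, gv]; omega
      · simp [gn]
      · rintro b hb π hH ⟨h4, h5⟩
        have kv := hH.reg .v rfl
        have kl := hH.reg .lo rfl
        simp [gv] at kv kl hb
        refine Runs.of_wp ?_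
        simp [kv, kl]
        refine ⟨fun v hv t => ?_, fun t ht => ?_⟩
        · rw [if_neg (by omega), h4 v hv]
        · split
          · omega
          · exact h5 t (by omega)
      · rintro π hH ⟨h4, h5⟩
        have kv := hH.reg .v rfl
        have km := hH.reg .m rfl
        have kd := fun i j => congrFun (congrFun (hH.arr .deg rfl) i) j
        simp [gv, gd] at kv kd h5 km
        simp [kv, kd, km, gm]
        refine ⟨fun v hv => ?_, ?_⟩
        · by_cases hva : v = a
          · subst hva
            simp
            exact ⟨by omega, h5⟩
          · simp [hva]
            have hv' : v < a := by omega
            refine ⟨(h1 v hv').1, fun t ht => ?_⟩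
            rw [h4 v hv']
            exact (h1 v hv').2 t ht
        · have : (a + 1) * σ₁.reg .nb = a * σ₁.reg .nb + σ₁.reg .nb := by ring
          omega
  · rintro τ hF ⟨h1, h2⟩
    have fn := hF.reg .n rfl
    have fb := hF.reg .nb rfl
    simp at fn fb h1 h2
    refine ⟨?_, ?_, ?_⟩ <;> rw [fn, fb]
    · exact fun v hv => (h1 v hv).1
    · exact fun v hv => (h1 v hv).2
    · exact h2

end Subprograms

/-! ### Cost of the matching algorithm and of returning the layout. -/

section Matching

attribute [local simp] wp Exp.eval Test.eval Exp.ofNat_eq Exp.add_eq Exp.sub_eq State.arr_setArr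
  State.arr_setArr_ne

variable {ω : ℕ → ℕ} {n k K T : ℕ}

/-- The boxes `0, …, b - 1` hold at most `cap` vertices each, all of them below `n`. -/
structure SlotsBounded (n b cap : ℕ) (σ : State) : Prop where
  cnt_le : ∀ j < b, σ.arr .cnt j 0 ≤ cap
  slot_lt : ∀ j < b, ∀ c < σ.arr .cnt j 0, σ.arr .slot j c < n

theorem SlotsBounded.of_eq {n b cap : ℕ} {σ τ : State} (h : SlotsBounded n b cap σ)
    (hc : τ.arr .cnt = σ.arr .cnt) (hs : τ.arr .slot = σ.arr .slot) : SlotsBounded n b cap τ := by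
  refine ⟨?_, ?_⟩ <;> rw [hc]
  · exact h.cnt_le
  · rw [hs]
    exact h.slot_lt

theorem slotsBounded_setReg {n b cap : ℕ} {σ : State} {y : Reg} {x : ℕ} :
    SlotsBounded n b cap (σ.setReg y x) ↔ SlotsBounded n b cap σ :=
  ⟨fun h => h.of_eq rfl rfl, fun h => h.of_eq rfl rfl⟩

theorem slotsBounded_setArr {n b cap : ℕ} {σ : State} {a : Arr} {i j x : ℕ} (h1 : .cnt ≠ a)
    (h2 : .slot ≠ a) : SlotsBounded n b cap (σ.setArr a i j x) ↔ SlotsBounded n b cap σ :=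
  have hc := State.arr_setArr_ne σ h1 i j x
  have hs := State.arr_setArr_ne σ h2 i j x
  ⟨fun h => h.of_eq hc.symm hs.symm, fun h => h.of_eq hc hs⟩

theorem AuxBounded.of_eq {σ τ : State} (h : AuxBounded σ) (hn : τ.reg .n = σ.reg .n)
    (hb : τ.reg .nb = σ.reg .nb) (hm : τ.reg .m = σ.reg .m) (hd : τ.arr .deg = σ.arr .deg)
    (hr : τ.arr .nbr = σ.arr .nbr) : AuxBounded τ := by
  refine ⟨?_, ?_, ?_⟩ <;> simp only [hn, hb, hm, hd, hr]
  · exact h.deg_le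
  · exact h.nbr_lt
  · exact h.m_le

/-- Only entries of `nbr` are ever enqueued, so queue entries are valid boxes. Hence the inner loops
run over at most `cap ≤ n` places, and over the neighbours of genuine vertices. -/
theorem runs_findLevels {σ : State} (hn : σ.reg .n = n) (hnb : σ.reg .nb ≤ K)
    (hcap : σ.reg .cap ≤ n) (hA : AuxBounded σ)
    (hS : SlotsBounded n (σ.reg .nb) (σ.reg .cap) σ) :
    Runs ω (counts n k K T) findLevels (fun _ => True) (fun _ => False) σ := by
  refine Runs.of_wp ?_
  simp only [findLevels, wp]
  refine Runs.loop (fun _ _ => True) ?_ trivial (fun _ _ _ _ _ => .of_wp (by simp)) ?_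
  · simp [counts, hnb]
  rintro σ₁ hF₁ -
  have en := hF₁.reg .n rfl
  have eb := hF₁.reg .nb rfl
  have em := hF₁.reg .m rfl
  have ec := hF₁.reg .cap rfl
  have ed := hF₁.arr .deg rfl
  have er := hF₁.arr .nbr rfl
  replace hA := hA.of_eq en eb em ed er
  replace hS := hS.of_eq (hF₁.arr .cnt rfl) (hF₁.arr .slot rfl)
  rw [← eb, ← ec] at hS
  rw [← eb] at hnb
  rw [← ec] at hcap
  rw [← en] at hn
  clear hF₁ en eb em ec ed er
  refine Runs.loop (fun _ τ => ∀ i < τ.reg .tail, τ.arr .queue i 0 < σ₁.reg .nb) ?_ ?_ ?_ ?_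
  · simp [counts, hn]
  · simp
  · rintro v hv τ hF h1
    have fb := hF.reg .nb rfl
    have fd := hF.arr .deg rfl
    have fr := hF.arr .nbr rfl
    simp at fb fd fr hv
    refine Runs.of_wp ?_
    simp
    refine ⟨fun _ => ?_, fun _ => h1⟩
    have hdv : σ₁.arr .deg v 0 ≤ K := (hA.deg_le v hv).trans hnb
    refine Runs.loop (fun _ τ => ∀ i < τ.reg .tail, τ.arr .queue i 0 < σ₁.reg .nb) ?_ ?_ ?_ ?_
    · simpa [counts, fd] using hdv
    · simpa using h1
    · rintro t ht ρ hG h2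
      have gr := hG.arr .nbr rfl
      have gv := hG.reg .v rfl
      simp [fr] at gr gv
      simp [fd] at ht
      refine Runs.of_wp ?_
      simp [gr, gv]
      refine ⟨fun _ i hi => ?_, fun _ => h2⟩
      split
      · exact hA.nbr_lt v hv t ht
      · exact h2 i (by omega)
    · exact fun ρ _ h => h
  · rintro τ hF h1
    have fn := hF.reg .n rfl
    have fb := hF.reg .nb rfl
    have fd := hF.arr .deg rfl
    have fr := hF.arr .nbr rfl
    have fc := hF.arr .cnt rfl
    have fs := hF.arr .slot rfl
    simp at fn fb fd fr fc fs
    refine Runs.loop (fun _ τ => ∀ i < τ.reg .tail, τ.arr .queue i 0 < σ₁.reg .nb) ?_ h1 ?_ ?_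
    · simpa [counts, fb] using hnb
    · rintro h hh ρ hG h2
      have gd := hG.arr .deg rfl
      have gr := hG.arr .nbr rfl
      have gc := hG.arr .cnt rfl
      have gs := hG.arr .slot rfl
      rw [fd] at gd
      rw [fr] at gr
      rw [fc] at gc
      rw [fs] at gs
      refine Runs.of_wp ?_
      simp [gc]
      refine fun hht => ⟨fun _ => ⟨fun _ => h2, fun _ => h2⟩, fun _ => ?_⟩
      have hj := h2 h hht
      refine Runs.loop (fun _ τ => ∀ i < τ.reg .tail, τ.arr .queue i 0 < σ₁.reg .nb) ?_ ?_ ?_ ?_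
      · simpa [counts, gc] using (hS.cnt_le _ hj).trans hcap
      · simpa using h2
      · rintro c hc π hH h3
        have ks := hH.arr .slot rfl
        have kd := hH.arr .deg rfl
        have kr := hH.arr .nbr rfl
        have kj := hH.reg .j rfl
        simp [gs, gd, gr] at ks kd kr kj
        simp [gc] at hc
        refine Runs.of_wp ?_
        simp [ks, kj]
        have hw := hS.slot_lt _ hj c hc
        rw [← hn] at hw
        refine Runs.loop (fun _ τ => ∀ i < τ.reg .tail, τ.arr .queue i 0 < σ₁.reg .nb) ?_ ?_ ?_ ?_
        · simpa [counts, kd] using (hA.deg_le _ hw).trans hnb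
        · simpa using h3
        · rintro t ht υ hI h4
          have lr := hI.arr .nbr rfl
          have lw := hI.reg .w rfl
          simp [kr] at lr lw
          simp [kd] at ht
          refine Runs.of_wp ?_
          simp [lr, lw]
          refine ⟨fun _ i hi => ?_, fun _ => h4⟩
          split
          · exact hA.nbr_lt _ hw t ht
          · exact h4 i (by omega)
        · exact fun _ _ h => h
      · exact fun _ _ h => h
    · exact fun _ _ _ => trivial

/-- The one increase of `cnt` happens at a box with a free place, and every value written to `slot`
is `v` or comes from the stack, hence is below `n` wherever it lands. -/
theorem wp_augment {σ : State} {b cap : ℕ} {Q R : State → Prop} (hnb : σ.reg .nb ≤ K)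
    (hS : SlotsBounded n b cap σ) (hv : σ.reg .v < n)
    (hc : σ.arr .cnt (σ.reg .j) 0 < cap) (hstk : ∀ i < σ.reg .d, σ.arr .stk i 0 < n)
    (hQ : ∀ τ, SlotsBounded n b cap τ → τ.reg .act = 0 → Q τ) :
    wp ω (counts n k K T) augment Q R σ := by
  simp [augment]
  refine Runs.loop (fun _ τ => SlotsBounded n b cap τ ∧ ∀ i < τ.reg .d, τ.arr .stk i 0 < n)
    ?_ ?_ ?_ ?_
  · simpa [counts] using hnb
  · refine ⟨⟨fun j hj => ?_, fun j hj c hc' => ?_⟩, by simpa using hstk⟩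
    · have := hS.cnt_le j hj
      simp
      split
      · omega
      · exact this
    · simp at hc' ⊢
      split
      · exact hv
      · next h =>
        refine hS.slot_lt j hj c ?_
        split at hc'
        · next h' =>
          subst h'
          have : c ≠ σ.arr .cnt (σ.reg .j) 0 := fun h'' => h ⟨rfl, h''⟩
          omega
        · exact hc'
  · rintro a ha τ hF ⟨h1, h2⟩
    refine Runs.of_wp ?_
    simp
    refine ⟨fun hd => ⟨⟨?_, ?_⟩, fun i hi => h2 i (by omega)⟩, fun hd => ?_⟩
    · simpa using h1.cnt_le
    · intro j hj c hc
      simp at hc ⊢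
      split
      · exact h2 _ (by omega)
      · exact h1.slot_lt j hj c hc
    · refine fun _ => hQ _ ⟨?_, ?_⟩ (by simp)
      · simpa using h1.cnt_le
      · simpa using h1.slot_lt
  · rintro τ hF ⟨h1, h2⟩
    refine hQ _ ⟨?_, ?_⟩ (by simp)
    · simpa using h1.cnt_le
    · simpa using h1.slot_lt

theorem runs_augmentPaths {σ : State} (hn : σ.reg .n = n) (hn1 : 1 ≤ n) (hnb : σ.reg .nb ≤ K)
    (hA : AuxBounded σ) (hS : SlotsBounded n (σ.reg .nb) (σ.reg .cap) σ) :
    Runs ω (counts n k K T) augmentPaths (SlotsBounded n (σ.reg .nb) (σ.reg .cap))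
      (fun _ => False) σ := by
  refine Runs.of_wp ?_
  simp only [augmentPaths, wp]
  -- While a path is active, its stack holds genuine vertices: a push reads `slot j (bptr j)` with
  -- `bptr j < cnt j`, which `SlotsBounded` covers.
  refine Runs.loop (fun _ τ => SlotsBounded n (σ.reg .nb) (σ.reg .cap) τ ∧
    (τ.reg .act ≠ 0 → ∀ i ≤ τ.reg .d, τ.arr .stk i 0 < n)) ?_ ?_ ?_ ?_
  · have h1 := hA.m_le
    have h2 : σ.reg .n * σ.reg .nb ≤ n * K := by rw [hn]; exact Nat.mul_le_mul_left _ hnb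
    simp [counts, hn]
    nlinarith
  · exact ⟨hS.of_eq rfl rfl, by simp⟩
  · rintro a ha τ hF ⟨h1, h2⟩
    have fn := hF.reg .n rfl
    have fb := hF.reg .nb rfl
    have fc := hF.reg .cap rfl
    have fd := hF.arr .deg rfl
    have fr := hF.arr .nbr rfl
    simp at fn fb fc fd fr
    refine Runs.of_wp ?_
    simp only [wp, slotsBounded_setReg]
    refine ⟨fun hact => ?_, fun hact => ?_⟩
    · simp at hact
      simp +contextual [slotsBounded_setReg, slotsBounded_setArr, fn, hn, h1, hact]
    simp at hact
    have hstk := h2 hact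
    have hvn := hstk (τ.reg .d) le_rfl
    have hpop : ∀ i ≤ τ.reg .d - 1, τ.arr .stk i 0 < n := fun i hi => hstk i (by omega)
    simp [slotsBounded_setReg, slotsBounded_setArr, fc, fd, fr, h1, hact]
    refine ⟨fun hptr => ?_, fun _ _ => hpop⟩
    have hj := hA.nbr_lt _ (by rwa [hn]) _ hptr
    refine ⟨fun _ => ⟨fun hc => ?_, fun _ => ⟨fun _ => ⟨fun hb i hi => ?_, fun _ => hstk⟩,
      fun _ => hstk⟩⟩, fun _ => hstk⟩
    · refine wp_augment (by simpa [fb] using hnb) (by simpa only [slotsBounded_setReg] using h1)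
        (by simpa using hvn)
        (by simpa using hc) (fun i hi => ?_) fun ρ hρ hact' => ⟨hρ, fun h => absurd hact' h⟩
      simp at hi ⊢
      exact hstk i hi.le
    · split
      · exact h1.slot_lt _ hj _ hb
      · exact hstk i (by omega)
  · exact fun _ _ h => h.1

theorem runs_matching {σ : State} (hn : σ.reg .n = n) (hn1 : 1 ≤ n) (hnb : σ.reg .nb ≤ K)
    (hcap : σ.reg .cap ≤ n) (hA : AuxBounded σ) :
    Runs ω (counts n k K T) matching (SlotsBounded n (σ.reg .nb) (σ.reg .cap))
      (fun _ => False) σ := by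
  refine Runs.of_wp ?_
  simp only [matching, wp]
  refine Runs.loop (fun _ _ => True) ?_ trivial (fun _ _ _ _ _ => .of_wp (by simp)) ?_
  · simp [counts, hn]
  rintro σ₁ hF₁ -
  refine Runs.loop (fun a τ => ∀ j < a, τ.arr .cnt j 0 = 0) ?_ (by simp) ?_ ?_
  · have := hF₁.reg .nb rfl
    simp at this
    simpa [counts, this] using hnb
  · rintro a ha τ hF h1
    refine Runs.of_wp ?_
    simp
    exact fun j hj hja => h1 j (by omega)
  rintro σ₂ hF₂ h0
  have en := (hF₂.reg .n rfl).trans (hF₁.reg .n rfl)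
  have eb := (hF₂.reg .nb rfl).trans (hF₁.reg .nb rfl)
  have em := (hF₂.reg .m rfl).trans (hF₁.reg .m rfl)
  have ec := (hF₂.reg .cap rfl).trans (hF₁.reg .cap rfl)
  have ed := (hF₂.arr .deg rfl).trans (hF₁.arr .deg rfl)
  have er := (hF₂.arr .nbr rfl).trans (hF₁.arr .nbr rfl)
  have eb1 := hF₂.reg .nb rfl
  simp at en eb em ec ed er eb1
  simp [← eb1, eb] at h0
  replace hA : AuxBounded σ₂ := hA.of_eq en eb em ed er
  rw [← eb] at h0 hnb
  rw [← ec] at hcap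
  rw [← en] at hn
  rw [← eb, ← ec]
  clear hF₁ hF₂ en eb em ec ed er eb1
  refine Runs.loop (fun _ => SlotsBounded n (σ₂.reg .nb) (σ₂.reg .cap)) ?_ ?_ ?_ ?_
  · simpa [counts] using hnb
  · exact ⟨fun j hj => by simp [h0 j hj], fun j hj => by simp [h0 j hj]⟩
  · rintro a ha τ hF hS
    have fn := hF.reg .n rfl
    have fb := hF.reg .nb rfl
    have fm := hF.reg .m rfl
    have fc := hF.reg .cap rfl
    have fd := hF.arr .deg rfl
    have fr := hF.arr .nbr rfl
    have hA' : AuxBounded (τ.setReg .l a) := hA.of_eq fn fb fm fd fr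
    have hS' : SlotsBounded n (τ.reg .nb) (τ.reg .cap) (τ.setReg .l a) := by
      rw [fb, fc]
      exact hS.of_eq rfl rfl
    refine Runs.seq ((runs_findLevels (σ := τ.setReg .l a) (fn.trans hn) (fb.trans_le hnb) (fc.trans_le hcap)
      hA' hS').consequence fun ρ hG _ => ?_)
    have gn := hG.reg .n rfl
    have gb := hG.reg .nb rfl
    have gm := hG.reg .m rfl
    have gc := hG.reg .cap rfl
    have gS := hS'.of_eq (hG.arr .cnt rfl) (hG.arr .slot rfl)
    have gA := hA'.of_eq gn gb gm (hG.arr .deg rfl) (hG.arr .nbr rfl)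
    simp at gn gb gc
    rw [← gb, ← gc] at gS
    refine Runs.branch (fun _ => ?_) (fun _ => .of_wp fun _ => ?_)
    · rw [← fb, ← fc, ← gb, ← gc]
      exact (runs_augmentPaths (gn.trans (fn.trans hn)) hn1 (by omega) gA gS).consequence
        fun _ _ h => h
    · rw [← fb, ← fc, ← gb, ← gc]
      exact gS
  · exact fun _ _ h => h

/-- The postconditions are arbitrary because the program ends with `ret`. -/
theorem runs_returnLayout {σ : State} {cap : ℕ} (hnb : σ.reg .nb ≤ K) (hcap : cap ≤ n)
    (hS : SlotsBounded n (σ.reg .nb) cap σ) {Q R : State → Prop} :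
    Runs ω (counts n k K T) returnLayout Q R σ := by
  refine Runs.of_wp ?_
  simp only [returnLayout, wp]
  refine Runs.loop (fun _ _ => True) ?_ trivial ?_ ?_
  · simpa [counts] using hnb
  · rintro j hj τ hF -
    have fc := hF.arr .cnt rfl
    simp at hj fc
    refine Runs.of_wp ?_
    simp only [wp]
    refine Runs.loop (fun _ _ => True) ?_ trivial (fun _ _ _ _ _ => .of_wp (by simp)) (by simp)
    simpa [counts, fc] using (hS.cnt_le j hj).trans hcap
  · simp

end Matching

/-! ### The whole algorithm, and the growth of its bounds. -/

section Algorithm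

attribute [local simp] wp Exp.eval Test.eval Exp.ofNat_eq Exp.add_eq Exp.sub_eq State.arr_setArr
  State.arr_setArr_ne

variable {ω : ℕ → ℕ} {n k K : ℕ}

theorem runs_tryPlacement {σ : State} {T : ℕ} (hn : σ.reg .n = n) (hn1 : 1 ≤ n)
    (hk : σ.reg .k ≤ k) (hnb1 : 1 ≤ σ.reg .nb) (hnb : σ.reg .nb ≤ K) (hcap : σ.reg .cap ≤ n) :
    Runs ω (counts n k K T) (.seq buildAuxGraph (.seq matching
      (.branch (.eq (.reg .matched) (.reg .n)) returnLayout nextPlacement)))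
      (fun _ => True) (fun _ => False) σ := by
  refine Runs.seq ((runs_buildAuxGraph hn hk hnb1 hnb).consequence fun τ hF hA => ?_)
  have fb := hF.reg .nb rfl
  have fc := hF.reg .cap rfl
  refine Runs.seq ((runs_matching ((hF.reg .n rfl).trans hn) hn1 (fb.trans_le hnb)
    (fc.trans_le hcap) hA).consequence fun ρ hG hS => ?_)
  have gb := hG.reg .nb rfl
  rw [← gb] at hS
  refine Runs.branch (fun _ => ?_) (fun _ => ?_)
  · exact runs_returnLayout (gb.trans fb |>.trans_le hnb) (fc.trans_le hcap) hS
  · exact runs_nextPlacement ((hG.reg .k rfl).trans (hF.reg .k rfl) |>.trans_le hk)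

/-- Box sizes `s + b` are at least `s`, so `n ≤ K * s` limits every layout to `K` boxes and `K ^ k`
placements. -/
theorem runs_algorithm1 {σ : State} (hn : σ.reg .n = n) (hn1 : 1 ≤ n) (hk : σ.reg .k ≤ k)
    (hK1 : 1 ≤ K) (hK : n ≤ K * σ.reg .s) :
    Runs ω (counts n k K (K ^ k)) algorithm1 (fun _ => True) (fun _ => False) σ := by
  refine Runs.seq ((runs_selectRoots hn hk).consequence fun σ₁ hF₁ hk₁ => ?_)
  have en := (hF₁.reg .n rfl).trans hn
  have es := hF₁.reg .s rfl
  rw [← es] at hK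
  refine Runs.loop (fun _ _ => True) ?_ trivial ?_ (fun _ _ _ => trivial)
  · simp [counts, en]
  rintro b hb τ hF -
  have fn := (hF.reg .n rfl).trans en
  have fk := hF.reg .k rfl
  have fs := hF.reg .s rfl
  refine Runs.seq (.of_wp ?_)
  have hcap : n ≤ K * (τ.reg .s + b) := by
    rw [fs, mul_add]
    omega
  simp
  refine Runs.branch (fun _ => .of_wp trivial) (fun hle => ?_)
  simp [fn] at hle
  refine Runs.seq ((runs_prepareLayout (by simpa using fn) hn1 (by simpa using hcap)).consequence
    fun τ₂ h₂ hnb => ?_)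
  have n2 := h₂.reg .n rfl
  have k2 := h₂.reg .k rfl
  have c2 := h₂.reg .cap rfl
  simp at n2 k2 c2
  have hk₂ : τ₂.reg .k ≤ k := by omega
  refine Runs.seq ((runs_firstPlacement hk₂ hnb.2).consequence fun τ₃ h₃ htot => ?_)
  have n3 := h₃.reg .n rfl
  have k3 := h₃.reg .k rfl
  have c3 := h₃.reg .cap rfl
  have b3 := h₃.reg .nb rfl
  refine Runs.loop (fun _ _ => True) ?_ trivial ?_ (fun _ _ _ => trivial)
  · simp only [Exp.eval, counts, htot]
    exact (Nat.pow_le_pow_left hnb.2 _).trans (Nat.pow_le_pow_right hK1 hk₂)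
  rintro p hp τ₄ h₄ -
  have n4 := h₄.reg .n rfl
  have k4 := h₄.reg .k rfl
  have c4 := h₄.reg .cap rfl
  have b4 := h₄.reg .nb rfl
  refine (runs_tryPlacement ?_ hn1 ?_ ?_ ?_ ?_).mono (fun _ h => h) (fun _ h => h.elim) <;>
    simp <;> omega

theorem one_le_counts {T : ℕ} (hn : 1 ≤ n) (hK : 1 ≤ K) (hT : 1 ≤ T) (e : Exp) :
    1 ≤ counts n k K T e := by
  have : 1 ≤ (K + 5) * n := one_le_mul (by omega) hn
  unfold counts
  split <;> omega

/-- The dominant nest is boxes, places, neighbours: `K * n * K`. Charging `n` places to each box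
costs only a further constant `K`. -/
theorem weight_findLevels_le {T : ℕ} (hn : 1 ≤ n) (hK : 1 ≤ K) :
    findLevels.weight (counts n k K T) ≤ K * (K + 5) * n := by
  have h1 : K * (n * K) ≤ K * (K + 5) * n := by nlinarith [Nat.zero_le (K * n)]
  have h2 : K ≤ K * (n * K) := Nat.le_mul_of_pos_right _ (by positivity)
  have h3 : n * K ≤ K * (n * K) := Nat.le_mul_of_pos_left _ hK
  simp only [findLevels, Cmd.weight, counts, max_self, mul_one, Nat.max_eq_right hK,
    Nat.max_eq_left hK, max_le_iff, Nat.max_eq_right (one_le_mul hn hK),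
    Nat.max_eq_left (one_le_mul hn hK)]
  omega

theorem weight_augmentPaths_le {T : ℕ} (hn : 1 ≤ n) (hK : 1 ≤ K) :
    augmentPaths.weight (counts n k K T) ≤ K * (K + 5) * n := by
  simp [augmentPaths, augment, Cmd.weight, counts, hK, Exp.add_eq]
  exact ⟨Nat.one_le_iff_ne_zero.2 (by positivity), (by ring : _ = _).le⟩

theorem weight_matching_le {T : ℕ} (hn : 1 ≤ n) (hK : 1 ≤ K) :
    matching.weight (counts n k K T) ≤ K * (K * (K + 5)) * n := by
  have h1 : n ≤ K * (K * (K + 5)) * n := Nat.le_mul_of_pos_left _ (by positivity)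
  have h2 : K ≤ K * (K * (K + 5)) * n := by
    rw [mul_assoc]
    exact Nat.le_mul_of_pos_right _ (by positivity)
  simp only [matching, Cmd.weight, counts, mul_one, max_le_iff]
  have h3 : 1 ≤ K * (K + 5) * n := Nat.one_le_iff_ne_zero.2 (by positivity)
  have h4 : K * max (findLevels.weight (counts n k K T))
      (max (augmentPaths.weight (counts n k K T)) 1) ≤ K * (K * (K + 5) * n) :=
    Nat.mul_le_mul_left _ (max_le (weight_findLevels_le hn hK)
      (max_le (weight_augmentPaths_le hn hK) h3))
  rw [← mul_assoc] at h4
  exact ⟨by omega, h1, h2, h4⟩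

theorem weight_buildAuxGraph_le {T : ℕ} (hn : 1 ≤ n) (hK : 1 ≤ K) :
    buildAuxGraph.weight (counts n k K T) ≤ 2 * K * (k + 1) * n ^ 2 := by
  simp [buildAuxGraph, searchFromRoots, Cmd.weight, counts, Exp.ofNat_eq]
  rw [max_eq_left hn]
  have h1 : n ≤ 2 * (n * n) := by nlinarith
  refine ⟨?_, Nat.one_le_iff_ne_zero.2 (by positivity), ?_⟩
  · rw [max_eq_right (a := 1) (by omega), max_eq_right h1]
    calc (k + 1) * (2 * (n * n)) = 2 * 1 * (k + 1) * n ^ 2 := by ring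
      _ ≤ 2 * K * (k + 1) * n ^ 2 := by gcongr
  · calc n * max (k + 1) (max K 1) ≤ n * (K * (k + 1)) := by
          gcongr
          exact max_le (Nat.le_mul_of_pos_left _ hK)
            (max_le (Nat.le_mul_of_pos_right _ (by omega)) (one_le_mul hK (by omega)))
      _ = 1 * K * (k + 1) * n ^ 1 := by ring
      _ ≤ 2 * K * (k + 1) * n ^ 2 := by
          gcongr <;> omega

theorem weight_algorithm1_le {T : ℕ} (hn : 1 ≤ n) (hK : 1 ≤ K) (hT : 1 ≤ T) :
    algorithm1.weight (counts n k K T) ≤ 2 * (K * (K * (K + 5))) * ((k + 1) * T) * n ^ 3 := by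
  simp [algorithm1, selectRoots, prepareLayout, firstPlacement, nextPlacement, returnLayout,
    Cmd.weight, counts, Exp.ofNat_eq]
  set M := K * (K * (K + 5)) with hM
  have hKM : K ≤ M := Nat.le_mul_of_pos_right _ (by positivity)
  have hM1 : 1 ≤ M := hK.trans hKM
  have hS : 1 ≤ k + 1 := by omega
  have hn2 : 1 ≤ n ^ 2 := Nat.one_le_pow _ _ hn
  have hnn : n ≤ n ^ 2 := Nat.le_self_pow (by norm_num) n
  set P := 2 * M * (k + 1) * n ^ 2 with hP
  -- `P` dominates the work for one placement; every nested product inside a placement fits this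
  -- pattern.
  have key : ∀ x y z u : ℕ, x ≤ 2 → y ≤ M → z ≤ k + 1 → u ≤ n ^ 2 → x * y * z * u ≤ P :=
    fun x y z u h1 h2 h3 h4 => by rw [hP]; gcongr
  have hPn : n ≤ P := by simpa using key 1 1 1 n (by omega) hM1 hS hnn
  have hP1 : 1 ≤ P := hn.trans hPn
  have hPk : k + 1 ≤ P := by simpa using key 1 1 (k + 1) 1 (by omega) hM1 le_rfl hn2
  have hPKk : (k + 1) * K ≤ P := by
    simpa [mul_comm] using key 1 K (k + 1) 1 (by omega) hKM le_rfl hn2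
  have hPKn : K * n ≤ P := by simpa using key 1 K 1 n (by omega) hKM hS hnn
  have hPb := (weight_buildAuxGraph_le (k := k) (T := T) hn hK).trans
    (key 2 K (k + 1) (n ^ 2) le_rfl hKM le_rfl le_rfl)
  have hPm : matching.weight (counts n k K T) ≤ P :=
    (weight_matching_le hn hK).trans (by simpa using key 1 M 1 n (by omega) le_rfl hS hnn)
  have hPT : P ≤ T * P := Nat.le_mul_of_pos_left _ hT
  have hTP : T * P ≤ n * (T * P) := Nat.le_mul_of_pos_left _ hn
  have hW : 2 * M * ((k + 1) * T) * n ^ 3 = n * (T * P) := by rw [hP]; ring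
  rw [hW, max_eq_left hK]
  refine ⟨by omega, by omega, Nat.mul_le_mul_left _ ?_⟩
  refine max_le (by omega) (max_le (by omega) (max_le (by omega) (Nat.mul_le_mul_left _ ?_)))
  exact max_le hPb (max_le hPm (max_le hPKn hPk))

/-- `c ^ k` is at most `(log n) ^ (A * log c)`, a power of the logarithm. From `n ≥ 3 > e` follows
`log (log n) ≥ 0`. -/
theorem exists_pow_log_log_le (c A : ℝ) (hc : 1 ≤ c) : ∃ C : ℝ, 0 ≤ C ∧ ∀ n : ℕ, 3 ≤ n → ∀ k : ℕ,
    (k : ℝ) ≤ A * Real.log (Real.log n) → c ^ k ≤ C * n := by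
  -- The maximum keeps the exponent positive for every sign of `A`; then `log n ≤ r * n ^ (1 / r)`
  -- is raised to the power `r`.
  set r : ℝ := max (A * Real.log c) 1 with hr
  have hr0 : 0 < r := lt_of_lt_of_le one_pos (le_max_right _ _)
  refine ⟨r ^ r, by positivity, fun n hn k hk => ?_⟩
  have hn' : (3 : ℝ) ≤ n := by exact_mod_cast hn
  have hlog : 1 ≤ Real.log n := by
    rw [Real.le_log_iff_exp_le (by linarith)]
    exact (Real.exp_one_lt_d9.le.trans (by norm_num)).trans hn'
  have hc0 : 0 < c := by linarith
  have hlc : 0 ≤ Real.log c := Real.log_nonneg hc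
  have h1 : c ^ k ≤ Real.log n ^ r := by
    rw [← Real.rpow_natCast, Real.rpow_def_of_pos hc0, Real.rpow_def_of_pos (by linarith)]
    refine Real.exp_le_exp.2 ?_
    calc Real.log c * k ≤ Real.log c * (A * Real.log (Real.log n)) := by gcongr
      _ = Real.log (Real.log n) * (A * Real.log c) := by ring
      _ ≤ Real.log (Real.log n) * r := by
        gcongr
        · exact Real.log_nonneg hlog
        · exact le_max_left _ _
  have h2 : Real.log n ≤ r * (n : ℝ) ^ (1 / r) := by
    have := Real.log_le_rpow_div (x := n) (by linarith) (ε := 1 / r) (by positivity)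
    rwa [div_div_eq_mul_div, div_one, mul_comm] at this
  calc c ^ k ≤ Real.log n ^ r := h1
    _ ≤ (r * (n : ℝ) ^ (1 / r)) ^ r := by gcongr
    _ = r ^ r * n := by
      rw [Real.mul_rpow hr0.le (by positivity), ← Real.rpow_mul (by linarith),
        one_div_mul_cancel hr0.ne', Real.rpow_one]

end Algorithm

/-! ### The constants in terms of `δ`. -/

theorem exists_matching_le {δ : ℝ} (hδ0 : 0 < δ) :
    ∃ C : ℝ, ∀ n : ℕ, 1 ≤ n → ∀ G : SimpleGraph (Fin n),
      ∀ cap : ℕ, δ * n ≤ cap → (cap : ℝ) ≤ n / 2 →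
      ∀ (ω : ℕ → ℕ) (σ τ : State), AtPlacement G cap σ →
        τ = (exec ω buildAuxGraph σ).st →
        (auxVertices τ : ℝ) ≤ C * n ∧
        (auxEdges τ : ℝ) ≤ C * n ∧
        ((exec ω matching τ).cost : ℝ) ≤
          C * (n : ℝ) ^ (3 / 2 : ℝ) := by
  set K : ℕ := ⌈1 / δ⌉₊ with hKdef
  have hK1 : 1 ≤ K := Nat.ceil_pos.2 (by positivity)
  set D : ℕ := K * (K * (K + 5)) * matching.bound (fun _ => 1) with hD
  refine ⟨((1 + K + D : ℕ) : ℝ), ?_⟩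
  rintro n hn1 G cap hcap hcap' ω σ τ hσ rfl
  have hn0 : (1 : ℝ) ≤ n := by exact_mod_cast hn1
  have hcap0 : (0 : ℝ) < cap := lt_of_lt_of_le (by positivity) hcap
  have hnb : σ.reg .nb ≤ K := by
    rw [hσ.reg_nb]
    refine Nat.ceil_mono ?_
    rw [div_le_div_iff₀ hcap0 hδ0]
    linarith
  have hnb1 : 1 ≤ σ.reg .nb := by
    rw [hσ.reg_nb]
    exact Nat.ceil_pos.2 (by positivity)
  have hcapn : cap ≤ n := by
    have : (cap : ℝ) ≤ n := by linarith
    exact_mod_cast this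
  have hF := frame_exec ω buildAuxGraph σ
  have hR := runs_buildAuxGraph (ω := ω) (T := 1) hσ.reg_n le_rfl hnb1 hnb
  set τ := (exec ω buildAuxGraph σ).st with hτ
  have hA : AuxBounded τ := by
    cases hx : (exec ω buildAuxGraph σ).exit with
    | next => exact hR.next hx
    | brk => exact (hR.brk hx).elim
    | ret => exact absurd hx (exit_ne_ret ω rfl σ)
  have en : τ.reg .n = n := (hF.reg .n rfl).trans hσ.reg_n
  have eb : τ.reg .nb ≤ K := (hF.reg .nb rfl).trans_le hnb
  have hc : τ.reg .cap ≤ n := ((hF.reg .cap rfl).trans hσ.reg_cap).trans_le hcapn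
  have hv : auxVertices τ ≤ (1 + K + D) * n := by
    rw [auxVertices, en]
    nlinarith
  have he : auxEdges τ ≤ (1 + K + D) * n := by
    rw [auxEdges]
    refine (Finset.sum_le_card_nsmul _ _ K fun v hv =>
      (hA.deg_le v (Finset.mem_range.1 hv)).trans eb).trans ?_
    rw [Finset.card_range, en, smul_eq_mul]
    nlinarith
  have hm : (exec ω matching τ).cost ≤ D * n := by
    refine (runs_matching (k := 0) (T := 1) en hn1 eb hc hA).cost.trans ?_
    refine (Cmd.bound_le_weight_mul (one_le_counts hn1 hK1 le_rfl) _).trans ?_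
    refine (Nat.mul_le_mul_right _ (weight_matching_le hn1 hK1)).trans_eq ?_
    rw [hD]
    ring
  refine ⟨by exact_mod_cast hv, by exact_mod_cast he, ?_⟩
  calc ((exec ω matching τ).cost : ℝ) ≤ D * n := by exact_mod_cast hm
    _ ≤ ((1 + K + D : ℕ) : ℝ) * (n : ℝ) ^ (3 / 2 : ℝ) := by
      gcongr
      · omega
      · exact Real.self_le_rpow_of_one_le hn0 (by norm_num)

/-- The running time is `O(n ^ 4)`, since there are `n ^ o(1)` placements for each of the at most
`n` box sizes and `O(n ^ 2)` steps of the search from each root. -/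
theorem exists_runningTime_le {δ : ℝ} (hδ0 : 0 < δ) (a : ℝ) :
    ∃ C : ℝ, ∀ n : ℕ, 3 ≤ n → ∀ G : SimpleGraph (Fin n),
      ∀ k : ℕ, (k : ℝ) ≤ a * (1 / δ * Real.log (Real.log n)) → ∀ ω : ℕ → ℕ,
        (runningTime δ G k ω : ℝ) ≤ C * (n : ℝ) ^ 4 := by
  set K : ℕ := ⌈1 / δ⌉₊ with hKdef
  have hK1 : 1 ≤ K := Nat.ceil_pos.2 (by positivity)
  have hK1' : (1 : ℝ) ≤ K := by exact_mod_cast hK1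
  -- The base `2 * K` rather than `K` absorbs the factor `k + 1 ≤ 2 ^ k` from the loops over the
  -- roots.
  obtain ⟨C, hC0, hC⟩ := exists_pow_log_log_le (2 * K) (a * (1 / δ)) (by linarith)
  set D : ℕ := 2 * (K * (K * (K + 5))) * algorithm1.bound (fun _ => 1) with hD
  refine ⟨D * C, fun n hn G k hk ω => ?_⟩
  have hn1 : 1 ≤ n := by omega
  have hKs : n ≤ K * ⌈δ * n⌉₊ := by
    have h1 : (n : ℝ) = 1 / δ * (δ * n) := by field_simp
    have h2 : (n : ℝ) ≤ K * ⌈δ * n⌉₊ := by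
      rw [h1]
      gcongr
      · exact Nat.le_ceil _
      · rw [← h1]
        exact Nat.le_ceil _
    exact_mod_cast h2
  have hT : 1 ≤ K ^ k := Nat.one_le_pow _ _ hK1
  have hrun : runningTime δ G k ω ≤ D * ((2 * K) ^ k * n ^ 3) := by
    refine (runs_algorithm1 (ω := ω) (σ := input δ G k) (n := n) (k := k) (K := K) rfl hn1 le_rfl
      hK1 hKs).cost.trans ?_
    refine (Cmd.bound_le_weight_mul (one_le_counts hn1 hK1 hT) _).trans ?_
    refine (Nat.mul_le_mul_right _ (weight_algorithm1_le hn1 hK1 hT)).trans ?_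
    have h2 : (k + 1) * K ^ k ≤ (2 * K) ^ k := by
      rw [mul_pow]
      exact Nat.mul_le_mul_right _ (Nat.lt_two_pow_self)
    calc _ = D * (((k + 1) * K ^ k) * n ^ 3) := by rw [hD]; ring
      _ ≤ _ := by gcongr
  calc (runningTime δ G k ω : ℝ) ≤ D * ((2 * K) ^ k * n ^ 3) := by exact_mod_cast hrun
    _ ≤ D * ((C * n) * n ^ 3) := by
      gcongr
      exact hC n hn k (by linarith)
    _ = D * C * (n : ℝ) ^ 4 := by ring

end DenseBandwidth

theorem lemma5 (δ : ℝ) (hδ0 : 0 < δ) (hδ1 : δ < 1) (a : ℝ) :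
    -- the auxiliary graphs have `O(n)` vertices and `O(n)` edges, and a matching step on such a
    -- graph takes `O(n ^ 1.5)` steps
    (∃ C : ℝ, ∀ n : ℕ, 1 ≤ n → ∀ G : SimpleGraph (Fin n), DenseBandwidth.IsDense δ G →
      ∀ cap : ℕ, δ * n ≤ cap → (cap : ℝ) ≤ n / 2 →
      ∀ (ω : ℕ → ℕ) (σ τ : DenseBandwidth.State), DenseBandwidth.AtPlacement G cap σ →
        τ = (DenseBandwidth.exec ω DenseBandwidth.buildAuxGraph σ).st →
        (DenseBandwidth.auxVertices τ : ℝ) ≤ C * n ∧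
        (DenseBandwidth.auxEdges τ : ℝ) ≤ C * n ∧
        ((DenseBandwidth.exec ω DenseBandwidth.matching τ).cost : ℝ) ≤ C * (n : ℝ) ^ (3 / 2 : ℝ)) ∧
    -- the running time of the algorithm is `O(n ^ (4 + o(1)))`
    ∃ e : ℕ → ℝ, Filter.Tendsto e Filter.atTop (nhds 0) ∧
      ∃ C : ℝ, ∀ n : ℕ, 3 ≤ n → ∀ G : SimpleGraph (Fin n), DenseBandwidth.IsDense δ G →
        ∀ k : ℕ, (k : ℝ) ≤ a * (1 / δ * Real.log (Real.log n)) → ∀ ω : ℕ → ℕ,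
          (DenseBandwidth.runningTime δ G k ω : ℝ) ≤ C * (n : ℝ) ^ (4 + e n) := by
  -- The polylogarithmic factor fits into the fourth power, so the exponent needs no correction.
  refine ⟨?_, fun _ => 0, tendsto_const_nhds, ?_⟩
  · obtain ⟨C, hC⟩ := DenseBandwidth.exists_matching_le hδ0
    exact ⟨C, fun n hn G _ => hC n hn G⟩
  · obtain ⟨C, hC⟩ := DenseBandwidth.exists_runningTime_le hδ0 a
    refine ⟨C, fun n hn G _ k hk ω => (hC n hn G k hk ω).trans_eq ?_⟩
    rw [add_zero]
    norm_cast
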